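/- Setting. Let $\mathcal H$ be a complex Hilbert space. A bounded operator $T$ on $\mathcal H$ is a near-isometry if there is $\delta>0$ with $\delta\|x\|\le\|Tx\|\le\|x\|$ for all $x\in\mathcal H$, and $T^{*m}T^{m+1}\mathcal H\subseteq T\mathcal H$ for all $m\ge 0$. Let $n\ge 2$ and $I_n=\{1,\dots,n\}$. A tuple $T=(T_1,\dots,T_n)$ of near-isometries on $\mathcal H$ is a doubly twisted near-isometry with respect to commuting unitaries $\{U_{ij}\}_{1\le i<j\le n}$ on $\mathcal H$ if for all $1\le i<j\le n$ and $1\le k\le n$ $$T_i^*T_j=U_{ij}^*T_jT_i^*,\qquad T_kU_{ij}=U_{ij}T_k,\qquad T_iT_j=U_{ij}T_jT_i .$$ For $A=\{a_1<\dots<a_m\}\subseteq I_n$ and $k\in\mathbb N_0^{m}$ put $T_A^{k}=T_{a_1}^{k_1}\cdots T_{a_m}^{k_m}$ (with $T_\emptyset^{k}=I$), $\mathcal W_A=\bigcap_{i\in A}\ker T_i^*$ (with $\mathcal W_\emptyset=\mathcal H$), and $$\mathcal D_A=\bigcap_{\ell\in\mathbb N_0^{n-m}}T_{I_n\setminus A}^{\ell}\,\mathcal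 W_A .$$ For a Hilbert space $\mathcal E$, $H^2_{\mathcal E}(\mathbb D^m)$ is the Hardy space of functions $f(z)=\sum_{k\in\mathbb N_0^m}z^k c_k$ on the polydisc with $c_k\in\mathcal E$ and $\|f\|^2=\sum_k\|c_k\|^2<\infty$; $z^k\otimes\eta$ denotes the function $z\mapsto z^k\eta$. For $m=0$ the space $H^2_{\mathcal E}(\mathbb D^0)$ is $\mathcal E$ itself. Theorem. Let $T=(T_1,\dots,T_n)$ be a doubly twisted near-isometry on $\mathcal H$. For every $A\subseteq I_n$ and $k\in\mathbb N_0^{|A|}$ let $\Lambda_{A,k}:\mathcal D_A\to T_A^k\mathcal D_A$ be the unitary factor of the polar decomposition $T_A^k|_{\mathcal D_A}=\Lambda_{A,k}P_{A,k}$, $P_{A,k}\ge 0$ on $\mathcal D_A$; these unitaries exist. Then for all $A=\{a_1<\dots<a_m\}\subseteq I_n$, $k\in\mathbb N_0^{m}$ and $\eta\in\mathcal D_A$ one has $T_{a_i}\Lambda_{A,k}\eta\in T_A^{k+e_i}\mathcal D_A$ for $1\le i\le m$ and $T_s\Lambda_{A,k}\eta\in T_A^{k}\mathcal D_A$ for $s\notin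 A$, and there are bounded operators $M_{A,s}$ $(A\subseteq I_n,\ 1\le s\le n)$ on $H^2_{\mathcal D_A}(\mathbb D^{|A|})$ with $$ M_{A,s}(z^{k}\otimes\eta)= \begin{cases} z^{k+e_i}\otimes\Lambda_{A,k+e_i}^*T_{a_i}\Lambda_{A,k}\,\eta & \text{if } s=a_i\in A,\\ z^{k}\otimes\Lambda_{A,k}^*T_{s}\Lambda_{A,k}\,\eta & \text{if } s\notin A, \end{cases} $$ for all $k\in\mathbb N_0^{|A|}$, $\eta\in\mathcal D_A$. With $M_{T,s}=\bigoplus_{A\subseteq I_n}M_{A,s}$, the tuple $T$ is unitarily equivalent to $(M_{T,1},\dots,M_{T,n})$, i.e. there is one unitary $V:\mathcal H\to\bigoplus_{A\subseteq I_n}H^2_{\mathcal D_A}(\mathbb D^{|A|})$ with $VT_sV^*=M_{T,s}$ for all $1\le s\le n$. -/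

import Mathlib

open scoped InnerProductSpace ENNReal

noncomputable section

/-! ### Vector-valued Hardy spaces over the polydisc -/

/-- The open unit polydisc `𝔻^ι` (a single point when `ι` is empty). -/
def Polydisc (ι : Type*) : Set (ι → ℂ) := {z | ∀ i, ‖z i‖ < 1}

/-- The monomial function `z ↦ z ^ k = ∏ i, z i ^ k i`. -/
def multiPow {ι : Type*} [Fintype ι] (k : ι → ℕ) (z : ι → ℂ) : ℂ := ∏ i, z i ^ k i

theorem integral_fourier_eq_zero {m : ℤ} (hm : m ≠ 0) :
    ∫ x : AddCircle (1 : ℝ), fourier m x ∂AddCircle.haarAddCircle = 0 :=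
  MeasureTheory.integral_eq_zero_of_add_right_eq_neg (μ := AddCircle.haarAddCircle)
    (fourier_add_half_inv_index hm one_pos)

theorem integral_prod_fourier {ι : Type*} [Fintype ι] [DecidableEq (ι → ℕ)] (k l : ι → ℕ) :
    ∫ x : ι → AddCircle (1 : ℝ), ∏ i, fourier ((k i : ℤ) - l i) (x i)
      ∂MeasureTheory.Measure.pi (fun _ => AddCircle.haarAddCircle) = if k = l then 1 else 0 := by
  rw [MeasureTheory.integral_fintype_prod_eq_prod (fun i x => fourier ((k i : ℤ) - l i) x)]
  split_ifs with hk
  · subst hk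
    simp
  · obtain ⟨i, hi⟩ := Function.ne_iff.mp hk
    exact Finset.prod_eq_zero (Finset.mem_univ i) (integral_fourier_eq_zero (by omega))

/-- A scalar power series that vanishes on the polydisc has zero coefficients. -/
theorem scalar_coeff_eq_zero {ι : Type*} [Fintype ι] (a : (ι → ℕ) → ℂ)
    (h : ∀ z ∈ Polydisc ι, HasSum (fun k => multiPow k z * a k) 0) (l : ι → ℕ) : a l = 0 := by
  classical
  obtain ⟨r, hr0, hr1⟩ : ∃ r : ℂ, r ≠ 0 ∧ ‖r‖ < 1 := ⟨1 / 2, by norm_num, by norm_num⟩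
  obtain ⟨w, hw⟩ : ∃ w : (ι → AddCircle (1 : ℝ)) → ι → ℂ, ∀ x i, w x i = r * fourier 1 (x i) :=
    ⟨_, fun _ _ => rfl⟩
  have hwD : ∀ x, w x ∈ Polydisc ι := by
    intro x i
    rw [hw, norm_mul, fourier_apply, Circle.norm_coe, mul_one]
    exact hr1
  have hwk : ∀ k x, multiPow k (w x) = (∏ i, r ^ k i) * ∏ i, fourier (k i : ℤ) (x i) := by
    intro k x
    rw [multiPow, ← Finset.prod_mul_distrib]
    refine Finset.prod_congr rfl fun i _ => ?_
    rw [hw, mul_pow]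
    congr 1
    simp [fourier_apply, AddCircle.toCircle_nsmul]
  obtain ⟨F, hF⟩ : ∃ F : (ι → ℕ) → (ι → AddCircle (1 : ℝ)) → ℂ, ∀ k x, F k x =
    ((∏ i, r ^ k i) * a k) * ∏ i, fourier ((k i : ℤ) - l i) (x i) := ⟨_, fun _ _ => rfl⟩
  have hFeq : ∀ k x, F k x = (∏ i, fourier (-(l i : ℤ)) (x i)) * (multiPow k (w x) * a k) := by
    intro k x
    simp only [hF, hwk, sub_eq_add_neg, fourier_add, Finset.prod_mul_distrib]
    ring
  have hnorm : ∀ k x, ‖F k x‖ = ‖(∏ i, r ^ k i) * a k‖ := by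
    intro k x
    simp only [hF, norm_mul, norm_prod, fourier_apply, Circle.norm_coe, Finset.prod_const_one,
      mul_one]
  have hsum0 : Summable fun k => ‖(∏ i, r ^ k i) * a k‖ := by
    have := (h (fun _ => r) (fun _ => hr1)).summable
    simpa only [multiPow] using this.norm
  have hcont : ∀ k, Continuous (F k) := by
    intro k
    rw [funext (hF k)]
    exact continuous_const.mul (continuous_finsetProd _ fun i _ =>
      (fourier ((k i : ℤ) - l i)).continuous.comp (continuous_apply i))
  have hint : ∀ k, MeasureTheory.Integrable (F k)
      (MeasureTheory.Measure.pi fun _ => AddCircle.haarAddCircle) := fun k =>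
    (MeasureTheory.integrable_const (‖(∏ i, r ^ k i) * a k‖)).mono'
      (hcont k).aestronglyMeasurable (Filter.Eventually.of_forall fun x => (hnorm k x).le)
  have hs := MeasureTheory.hasSum_integral_of_summable_integral_norm hint (by
    simpa only [hnorm, MeasureTheory.integral_const, MeasureTheory.probReal_univ, one_smul]
      using hsum0)
  have hz : ∀ x, ∑' k, F k x = 0 := by
    intro x
    simp only [hFeq]
    rw [((h (w x) (hwD x)).mul_left _).tsum_eq, mul_zero]
  simp only [hz, MeasureTheory.integral_zero] at hs
  simp only [hF, MeasureTheory.integral_const_mul, integral_prod_fourier, mul_ite, mul_one,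
    mul_zero] at hs
  have h1 := hs.unique (hasSum_single l fun k hk => if_neg hk)
  rw [if_pos rfl] at h1
  exact (mul_eq_zero.mp h1.symm).resolve_left
    (Finset.prod_ne_zero_iff.mpr fun i _ => pow_ne_zero _ hr0)

variable (ι : Type*) [Fintype ι] (E : Type*) [NormedAddCommGroup E] [InnerProductSpace ℂ E]

/-- The `E`-valued functions on the polydisc of the form `f z = ∑ₖ zᵏ cₖ` with
`∑ₖ ‖cₖ‖² < ∞`, as a space of functions. -/
def hardySubmodule : Submodule ℂ (Polydisc ι → E) where
  carrier := {f | ∃ c : lp (fun _ : ι → ℕ => E) 2,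
    ∀ z : Polydisc ι, HasSum (fun k => multiPow k z.1 • c k) (f z)}
  add_mem' := by
    rintro f g ⟨c, hc⟩ ⟨d, hd⟩
    exact ⟨c + d, fun z => by simpa using (hc z).add (hd z)⟩
  zero_mem' := ⟨0, fun z => by simp⟩
  smul_mem' := by
    rintro a f ⟨c, hc⟩
    exact ⟨a • c, fun z => by
      have h := (hc z).const_smul a
      simp only [smul_comm a] at h
      exact h⟩

/-- The `E`-valued Hardy space `H²_E(𝔻^ι)`. -/
def HardySpace : Type _ := hardySubmodule ι E

namespace HardySpace

variable {ι E}

instance : AddCommGroup (HardySpace ι E) := inferInstanceAs (AddCommGroup (hardySubmodule ι E))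

instance : Module ℂ (HardySpace ι E) := inferInstanceAs (Module ℂ (hardySubmodule ι E))

instance : CoeFun (HardySpace ι E) fun _ => Polydisc ι → E := ⟨fun f => f.1⟩

theorem exists_coeff (f : HardySpace ι E) : ∃ c : lp (fun _ : ι → ℕ => E) 2,
    ∀ z : Polydisc ι, HasSum (fun k => multiPow k z.1 • c k) (f z) := f.2

theorem coeff_unique {g : Polydisc ι → E} {c d : (ι → ℕ) → E}
    (hc : ∀ z : Polydisc ι, HasSum (fun k => multiPow k z.1 • c k) (g z))
    (hd : ∀ z : Polydisc ι, HasSum (fun k => multiPow k z.1 • d k) (g z)) : c = d := by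
  funext l
  rw [← sub_eq_zero, ← inner_self_eq_zero (𝕜 := ℂ)]
  refine scalar_coeff_eq_zero (fun k => ⟪c l - d l, c k - d k⟫_ℂ) (fun z hz => ?_) l
  have := ((hc ⟨z, hz⟩).sub (hd ⟨z, hz⟩)).mapL (innerSL ℂ (c l - d l))
  simpa only [← smul_sub, innerSL_apply_apply, inner_smul_right, sub_self, inner_zero_right]
    using this

/-- The sequence of power series coefficients of a function in the Hardy space. -/
def coeff : HardySpace ι E →ₗ[ℂ] lp (fun _ : ι → ℕ => E) 2 where
  toFun f := f.exists_coeff.choose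
  map_add' f g := Subtype.ext <| coeff_unique (f + g).exists_coeff.choose_spec fun z => by
    have h := (f.exists_coeff.choose_spec z).add (g.exists_coeff.choose_spec z)
    simp only [← smul_add] at h
    exact h
  map_smul' a f := Subtype.ext <| coeff_unique (a • f).exists_coeff.choose_spec fun z => by
    have h := (f.exists_coeff.choose_spec z).const_smul a
    simp only [smul_comm a] at h
    exact h

theorem hasSum_coeff (f : HardySpace ι E) (z : Polydisc ι) :
    HasSum (fun k => multiPow k z.1 • coeff f k) (f z) := f.exists_coeff.choose_spec z

theorem coeff_injective : Function.Injective (coeff : HardySpace ι E →ₗ[ℂ] _) := by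
  intro f g h
  refine Subtype.ext (funext fun z => (f.hasSum_coeff z).unique ?_)
  rw [h]
  exact g.hasSum_coeff z

/-- The Hardy norm: `‖f‖² = ∑ₖ ‖cₖ‖²`. -/
instance : NormedAddCommGroup (HardySpace ι E) :=
  NormedAddCommGroup.induced _ _ (coeff : HardySpace ι E →ₗ[ℂ] _) coeff_injective

/-- The Hardy inner product: `⟪f, g⟫ = ∑ₖ ⟪cₖ(f), cₖ(g)⟫`. -/
instance : InnerProductSpace ℂ (HardySpace ι E) :=
  InnerProductSpace.induced (coeff : HardySpace ι E →ₗ[ℂ] _)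

/-- The elementary tensor `zᵏ ⊗ η`, i.e. the function `z ↦ zᵏ η`. -/
def monomial (k : ι → ℕ) (η : E) : HardySpace ι E :=
  ⟨fun z => multiPow k z.1 • η, by
    classical
    refine ⟨lp.single 2 k η, fun z => ?_⟩
    convert hasSum_ite_eq k (multiPow k z.1 • η) using 2 with j
    split_ifs with h
    · subst h; simp
    · simp [h]⟩

end HardySpace

/-! ### Doubly twisted near-isometries -/

section Operators

variable {H : Type*} [NormedAddCommGroup H] [InnerProductSpace ℂ H]

/-- A near-isometry: a bounded below contraction with `T*ᵐ Tᵐ⁺¹ H ⊆ T H` for all `m ≥ 0`. -/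
structure IsNearIsometry [CompleteSpace H] (T : H →L[ℂ] H) : Prop where
  bounds : ∃ δ : ℝ, 0 < δ ∧ ∀ x, δ * ‖x‖ ≤ ‖T x‖ ∧ ‖T x‖ ≤ ‖x‖
  range_le : ∀ (m : ℕ) (x : H),
    ((ContinuousLinearMap.adjoint T) ^ m) ((T ^ (m + 1)) x) ∈ Set.range T

/-- `T = (T₁, …, Tₙ)` is a doubly twisted near-isometry with respect to the commuting unitaries
`U i j`, `i < j` (the values `U i j` with `i ≥ j` play no role). -/
structure IsDoublyTwistedNearIsometry [CompleteSpace H] {n : ℕ} (T : Fin n → H →L[ℂ] H)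
    (U : Fin n → Fin n → H →L[ℂ] H) : Prop where
  two_le : 2 ≤ n
  unitary : ∀ i j, i < j → U i j ∈ unitary (H →L[ℂ] H)
  commute : ∀ i j p q, i < j → p < q → U i j * U p q = U p q * U i j
  nearIsometry : ∀ i, IsNearIsometry (T i)
  adjoint_mul : ∀ i j, i < j → ContinuousLinearMap.adjoint (T i) * T j =
    ContinuousLinearMap.adjoint (U i j) * T j * ContinuousLinearMap.adjoint (T i)
  mul_unitary : ∀ i j k, i < j → T k * U i j = U i j * T k
  mul_mul : ∀ i j, i < j → T i * T j = U i j * T j * T i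

variable {n : ℕ}

/-- `T_A ^ k = T_{a₁} ^ k₁ ⋯ T_{aₘ} ^ kₘ` for `A = {a₁ < ⋯ < aₘ}`, the factors being taken in
increasing order of the index; the multi-index `k` is indexed by the elements of `A`. -/
def tuplePow (T : Fin n → H →L[ℂ] H) (A : Finset (Fin n)) (k : A → ℕ) : H →L[ℂ] H :=
  ((List.finRange n).map fun i => if h : i ∈ A then T i ^ k ⟨i, h⟩ else 1).prod

/-- `W_A = ⋂_{i ∈ A} ker T_i*`. -/
def kernelSubspace [CompleteSpace H] (T : Fin n → H →L[ℂ] H) (A : Finset (Fin n)) :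
    Submodule ℂ H :=
  ⨅ i ∈ A, (ContinuousLinearMap.adjoint (T i)).ker

/-- The image `L D` of a subspace `D` under an operator `L`. -/
abbrev imageSubspace (L : H →L[ℂ] H) (D : Submodule ℂ H) : Submodule ℂ H :=
  D.map (L : H →ₗ[ℂ] H)

/-- The `A`-wandering subspace `D_A = ⋂_ℓ T_{Aᶜ} ^ ℓ W_A`. -/
def wanderingSubspace [CompleteSpace H] (T : Fin n → H →L[ℂ] H) (A : Finset (Fin n)) :
    Submodule ℂ H :=
  ⨅ l : (Aᶜ : Finset (Fin n)) → ℕ, imageSubspace (tuplePow T Aᶜ l) (kernelSubspace T A)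

/-- `Λ : D → L D` is the unitary factor of the polar decomposition `L|_D = Λ |L|_D|` of the
restriction `L|_D : D → L D`: one has `L|_D = Λ P` with `P` a positive operator on `D`. -/
def IsPolarUnitary (L : H →L[ℂ] H) (D : Submodule ℂ H) (Λ : D ≃ₗᵢ[ℂ] imageSubspace L D) : Prop :=
  ∃ P : D →L[ℂ] D, P.IsPositive ∧ ∀ x : D, L x = Λ (P x)

/-- The Hilbert space direct sum of operators `M a` on `E a`, over a finite index set. -/
def directSumOperator {α : Type*} [Fintype α] {E : α → Type*} [∀ a, NormedAddCommGroup (E a)]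
    [∀ a, InnerProductSpace ℂ (E a)] (M : ∀ a, E a →L[ℂ] E a) : PiLp 2 E →L[ℂ] PiLp 2 E :=
  (PiLp.continuousLinearEquiv 2 ℂ E).symm.toContinuousLinearMap ∘L
    ContinuousLinearMap.piMap M ∘L (PiLp.continuousLinearEquiv 2 ℂ E).toContinuousLinearMap

/-- Unitary equivalence of tuples: `U T_i U* = S_i` for all `i`, for one unitary `U`. -/
def TupleUnitarilyEquivalent {α K : Type*} [NormedAddCommGroup K] [InnerProductSpace ℂ K]
    (T : α → H →L[ℂ] H) (S : α → K →L[ℂ] K) : Prop :=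
  ∃ U : H ≃ₗᵢ[ℂ] K, ∀ i y, U (T i (U.symm y)) = S i y

end Operators

end

/-! ### Wold decomposition of a single near-isometry -/

section WoldDecomposition

variable {H : Type*} [NormedAddCommGroup H] [InnerProductSpace ℂ H]

/-! A near-isometry `T` splits `H` orthogonally into `T ^ m (ker T*)`, `m < ∞`, and the component
`⋂ₘ T ^ m H` of index `∞`. Orthogonality is what `T*ᵐ Tᵐ⁺¹ H ⊆ T H = (ker T*)ᗮ` provides, and
totality follows by repeatedly splitting off `ker T*`. Since `∞ + 1 = ∞`, the operator carries the
component of index `α` onto that of index `α + 1` for every `α : ℕ∞`.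

In a doubly twisted tuple, `T j` and `T j*` preserve the components of `T i` for `i ≠ j`, so these
components reduce `T j`. Hence the intersections over `i`, indexed by `α : Fin n → ℕ∞`, are again
orthogonal and total, and `T i` carries the one of index `α` onto that of index `α + e_i`
(`map_jointWoldComponent`).

An index `α` is the same as a pair `(A, k)`: `A` is the set where `α` is finite and `k` its values
there. The component of `(A, 0)` is `D_A` and that of `(A, k)` is `T_A ^ k D_A`, so `H = ⨁ T_A ^ k
D_A` over all `(A, k)`. The model space is likewise the sum of the `zᵏ ⊗ D_A`. The polar unitaries
`Λ A k` identify the two sums summand by summand. Transporting `T s` along this unitary gives a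
bounded operator with the required values on monomials; it is block diagonal because `T s` changes
only `k`, never `A`. -/

theorem pow_succ_apply (T : H →L[ℂ] H) (m : ℕ) (x : H) :
    (T ^ (m + 1)) x = (T ^ m) (T x) := by
  rw [pow_succ]; rfl

theorem pow_succ_apply' (T : H →L[ℂ] H) (m : ℕ) (x : H) : (T ^ (m + 1)) x = T ((T ^ m) x) := by
  rw [pow_succ']; rfl

/-- An operator bounded below by a positive multiple of the norm. -/
def IsBoundedBelow (T : H →L[ℂ] H) : Prop := ∃ δ : ℝ, 0 < δ ∧ ∀ x, δ * ‖x‖ ≤ ‖T x‖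

theorem IsBoundedBelow.one : IsBoundedBelow (1 : H →L[ℂ] H) := ⟨1, one_pos, fun x => by simp⟩

theorem IsBoundedBelow.mul {S T : H →L[ℂ] H} (hS : IsBoundedBelow S) (hT : IsBoundedBelow T) :
    IsBoundedBelow (S * T) := by
  obtain ⟨a, ha, hSa⟩ := hS
  obtain ⟨b, hb, hTb⟩ := hT
  refine ⟨a * b, mul_pos ha hb, fun x => ?_⟩
  calc a * b * ‖x‖ = a * (b * ‖x‖) := by ring
    _ ≤ a * ‖T x‖ := by gcongr; exact hTb x
    _ ≤ ‖S (T x)‖ := hSa _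

theorem IsBoundedBelow.pow {T : H →L[ℂ] H} (hT : IsBoundedBelow T) (m : ℕ) :
    IsBoundedBelow (T ^ m) := by
  induction m with
  | zero => exact .one
  | succ m ih => rw [pow_succ]; exact ih.mul hT

theorem IsBoundedBelow.list_prod {l : List (H →L[ℂ] H)} (hl : ∀ S ∈ l, IsBoundedBelow S) :
    IsBoundedBelow l.prod := by
  induction l with
  | nil => exact .one
  | cons S l ih =>
    rw [List.prod_cons]
    exact (hl S (by simp)).mul (ih fun R hR => hl R (by simp [hR]))

theorem IsBoundedBelow.antilipschitz {T : H →L[ℂ] H} (hT : IsBoundedBelow T) :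
    ∃ K, AntilipschitzWith K T := by
  obtain ⟨δ, hδ, h⟩ := hT
  refine ⟨⟨δ⁻¹, by positivity⟩, T.antilipschitz_of_bound fun x => ?_⟩
  change ‖x‖ ≤ δ⁻¹ * ‖T x‖
  rw [inv_mul_eq_div, le_div_iff₀ hδ, mul_comm]
  exact h x

theorem IsBoundedBelow.injective {T : H →L[ℂ] H} (hT : IsBoundedBelow T) :
    Function.Injective T := by
  obtain ⟨K, hK⟩ := hT.antilipschitz
  exact hK.injective

theorem IsBoundedBelow.isClosed_map [CompleteSpace H] {T : H →L[ℂ] H} (hT : IsBoundedBelow T)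
    {D : Submodule ℂ H} (hD : IsClosed (D : Set H)) :
    IsClosed ((imageSubspace T D : Submodule ℂ H) : Set H) := by
  obtain ⟨K, hK⟩ := hT.antilipschitz
  rw [Submodule.map_coe]
  exact (hK.isClosedEmbedding T.uniformContinuous).isClosedMap _ hD

variable [CompleteSpace H]

theorem IsNearIsometry.isBoundedBelow {T : H →L[ℂ] H} (hT : IsNearIsometry T) :
    IsBoundedBelow T := by
  obtain ⟨δ, hδ, h⟩ := hT.bounds
  exact ⟨δ, hδ, fun x => (h x).1⟩

/-- The components of the Wold decomposition of a near-isometry `T`: the subspaces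
`T ^ m (ker T*)` for finite `m`, and `⋂ₘ T ^ m H` for `m = ∞`. -/
noncomputable def woldComponent (T : H →L[ℂ] H) (α : ℕ∞) : Submodule ℂ H :=
  α.recTopCoe (⨅ m : ℕ, imageSubspace (T ^ m) ⊤)
    fun m => imageSubspace (T ^ m) (ContinuousLinearMap.adjoint T).ker

theorem mem_woldComponent_top {T : H →L[ℂ] H} {x : H} :
    x ∈ woldComponent T ⊤ ↔ ∀ m : ℕ, ∃ y, (T ^ m) y = x := by
  simp only [woldComponent, ENat.recTopCoe_top, Submodule.mem_iInf, Submodule.mem_map,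
    Submodule.mem_top, true_and, ContinuousLinearMap.coe_coe]

theorem mem_woldComponent_coe {T : H →L[ℂ] H} {m : ℕ} {x : H} :
    x ∈ woldComponent T m ↔ ∃ y, ContinuousLinearMap.adjoint T y = 0 ∧ (T ^ m) y = x := by
  simp only [woldComponent, ENat.recTopCoe_natCast, Submodule.mem_map, LinearMap.mem_ker,
    ContinuousLinearMap.coe_coe]

theorem IsBoundedBelow.isClosed_woldComponent {T : H →L[ℂ] H} (hT : IsBoundedBelow T) (α : ℕ∞) :
    IsClosed (woldComponent T α : Set H) := by
  induction α with
  | top =>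
    rw [woldComponent, ENat.recTopCoe_top, Submodule.coe_iInf]
    exact isClosed_iInter fun m => (hT.pow m).isClosed_map isClosed_univ
  | coe m =>
    rw [woldComponent, ENat.recTopCoe_natCast]
    exact (hT.pow m).isClosed_map (ContinuousLinearMap.isClosed_ker _)

/-- `T` maps each Wold component onto the next one. -/
theorem IsBoundedBelow.map_mem_woldComponent_iff {T : H →L[ℂ] H} (hT : IsBoundedBelow T) {α : ℕ∞}
    {x : H} : T x ∈ woldComponent T (α + 1) ↔ x ∈ woldComponent T α := by
  induction α with
  | top =>
    rw [top_add, mem_woldComponent_top, mem_woldComponent_top]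
    refine ⟨fun h m => ?_, fun h m => ?_⟩
    · obtain ⟨y, hy⟩ := h (m + 1)
      rw [pow_succ_apply'] at hy
      exact ⟨y, hT.injective hy⟩
    · obtain ⟨y, rfl⟩ := h m
      exact ⟨T y, by rw [← pow_succ_apply, pow_succ_apply']⟩
  | coe m =>
    rw [← Nat.cast_succ, mem_woldComponent_coe, mem_woldComponent_coe]
    simp only [Nat.succ_eq_add_one, pow_succ_apply', hT.injective.eq_iff]

theorem exists_map_eq_of_mem_woldComponent_add_one {T : H →L[ℂ] H} {α : ℕ∞} {x : H}
    (hx : x ∈ woldComponent T (α + 1)) : ∃ y, T y = x := by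
  induction α with
  | top =>
    obtain ⟨y, hy⟩ := mem_woldComponent_top.1 hx 1
    exact ⟨y, by simpa using hy⟩
  | coe m =>
    rw [← Nat.cast_succ, mem_woldComponent_coe] at hx
    obtain ⟨y, -, rfl⟩ := hx
    exact ⟨_, (pow_succ_apply' T m y).symm⟩

theorem exists_pow_apply_eq_of_mem_woldComponent {T : H →L[ℂ] H} {α : ℕ∞} {m : ℕ} (hα : m ≤ α)
    {x : H} (hx : x ∈ woldComponent T α) : ∃ y, (T ^ m) y = x := by
  induction α with
  | top => exact mem_woldComponent_top.1 hx m
  | coe l =>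
    obtain ⟨y, -, rfl⟩ := mem_woldComponent_coe.1 hx
    obtain ⟨j, rfl⟩ := Nat.exists_eq_add_of_le (Nat.cast_le.1 hα)
    exact ⟨(T ^ j) y, by rw [pow_add]; rfl⟩

theorem inner_pow_apply_left (T : H →L[ℂ] H) (m : ℕ) (x y : H) :
    ⟪(T ^ m) x, y⟫_ℂ = ⟪x, (ContinuousLinearMap.adjoint T ^ m) y⟫_ℂ := by
  rw [← ContinuousLinearMap.adjoint_inner_right, ← ContinuousLinearMap.star_eq_adjoint, star_pow,
    ContinuousLinearMap.star_eq_adjoint]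

/-- Moving `T ^ m` to the other side turns the second vector into `T*ᵐ Tᵐ⁺¹ y`. This lies in `T H`
by the near-isometry condition, hence is orthogonal to `ker T*`. -/
theorem IsNearIsometry.inner_eq_zero_of_mem_woldComponent {T : H →L[ℂ] H} (hT : IsNearIsometry T)
    {m : ℕ} {x : H} (hx : x ∈ woldComponent T m) (y : H) : ⟪x, (T ^ (m + 1)) y⟫_ℂ = 0 := by
  obtain ⟨w, hw, rfl⟩ := mem_woldComponent_coe.1 hx
  obtain ⟨z, hz⟩ := hT.range_le m y
  rw [inner_pow_apply_left, ← hz, ← ContinuousLinearMap.adjoint_inner_left, hw,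
    inner_zero_left]

theorem IsNearIsometry.woldComponent_orthogonal {T : H →L[ℂ] H} (hT : IsNearIsometry T)
    {α β : ℕ∞} (h : α ≠ β) {x y : H} (hx : x ∈ woldComponent T α) (hy : y ∈ woldComponent T β) :
    ⟪x, y⟫_ℂ = 0 := by
  wlog hlt : α < β generalizing α β x y
  · rw [inner_eq_zero_symm]
    exact this h.symm hy hx (lt_of_le_of_ne (not_lt.1 hlt) h.symm)
  obtain ⟨m, rfl⟩ := ENat.ne_top_iff_exists.1 hlt.ne_top
  obtain ⟨z, rfl⟩ := exists_pow_apply_eq_of_mem_woldComponent (m := m + 1)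
    (by exact_mod_cast Order.add_one_le_of_lt hlt) hy
  exact hT.inner_eq_zero_of_mem_woldComponent hx z

/-- The Wold components of a near-isometry span a dense subspace. -/
theorem IsNearIsometry.eq_zero_of_forall_woldComponent {T : H →L[ℂ] H} (hT : IsNearIsometry T)
    {x : H} (hx : ∀ α, ∀ y ∈ woldComponent T α, ⟪y, x⟫_ℂ = 0) : x = 0 := by
  -- Once `x` lies in every `T ^ m H`, it belongs to the component of index `∞` and is therefore
  -- orthogonal to itself.
  refine inner_self_eq_zero.1 (hx ⊤ x (mem_woldComponent_top.2 fun m => ?_))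
  induction m with
  | zero => exact ⟨x, rfl⟩
  | succ m ih =>
    obtain ⟨y, hy⟩ := ih
    have hcl : IsClosed ((imageSubspace T ⊤ : Submodule ℂ H) : Set H) :=
      hT.isBoundedBelow.isClosed_map isClosed_univ
    have : CompleteSpace (imageSubspace T ⊤ : Submodule ℂ H) := hcl.completeSpace_coe
    -- With `x = T ^ m y` and `y = T z + w`, `w ∈ ker T*`, pairing `x` with `T ^ m w` leaves `‖T ^ m
    -- w‖²`. Hence `T ^ m w = 0` and `x = T ^ (m + 1) z`.
    obtain ⟨-, ⟨z, -, rfl⟩, w, hw, hyw⟩ :=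
      (imageSubspace T ⊤ : Submodule ℂ H).exists_add_mem_mem_orthogonal y
    have hw0 : ContinuousLinearMap.adjoint T w = 0 := by
      refine ext_inner_left ℂ fun v => ?_
      rw [ContinuousLinearMap.adjoint_inner_right, inner_zero_right]
      exact hw _ ⟨v, trivial, rfl⟩
    have hwm : (T ^ m) w ∈ woldComponent T m := mem_woldComponent_coe.2 ⟨w, hw0, rfl⟩
    have hsplit : x = (T ^ (m + 1)) z + (T ^ m) w := by
      rw [← hy, hyw, map_add, pow_succ_apply]; rfl
    have h0 := hx m _ hwm
    rw [hsplit, inner_add_right, hT.inner_eq_zero_of_mem_woldComponent hwm, zero_add,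
      inner_self_eq_zero] at h0
    exact ⟨z, by rw [hsplit, h0, add_zero]⟩

/-- An operator commuting with `T` and `T*` up to twists leaves the Wold components invariant. -/
theorem map_mem_woldComponent_of_twisted {T S V V' : H →L[ℂ] H}
    (h₁ : S * T = V * T * S) (h₂ : Commute T V) (h₃ : Commute (ContinuousLinearMap.adjoint T) V)
    (h₄ : ContinuousLinearMap.adjoint T * S = V' * S * ContinuousLinearMap.adjoint T)
    {α : ℕ∞} {x : H} (hx : x ∈ woldComponent T α) : S x ∈ woldComponent T α := by
  have key : ∀ m : ℕ, S * T ^ m = T ^ m * (V ^ m * S) := by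
    intro m
    induction m with
    | zero => simp
    | succ m ih =>
      rw [pow_succ, ← mul_assoc, ih, mul_assoc, mul_assoc, h₁, ← h₂.eq, ← mul_assoc (V ^ m),
        ← mul_assoc (V ^ m), ← ((h₂.pow_right m).eq), pow_succ]
      simp only [mul_assoc]
  have key' : ∀ m y, S ((T ^ m) y) = (T ^ m) ((V ^ m) (S y)) := fun m y =>
    congrArg (fun L : H →L[ℂ] H => L y) (key m)
  induction α with
  | top =>
    rw [mem_woldComponent_top] at hx ⊢
    intro m
    obtain ⟨y, rfl⟩ := hx m
    exact ⟨_, (key' m y).symm⟩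
  | coe m =>
    rw [mem_woldComponent_coe] at hx ⊢
    obtain ⟨y, hy, rfl⟩ := hx
    -- The new preimage `V ^ m (S y)` is still in `ker T*`: `T*` passes through `V ^ m`, and then
    -- through `S` at the cost of `V'`.
    refine ⟨_, ?_, (key' m y).symm⟩
    have e1 : ContinuousLinearMap.adjoint T ((V ^ m) (S y)) =
        (V ^ m) (ContinuousLinearMap.adjoint T (S y)) :=
      congrArg (fun L : H →L[ℂ] H => L (S y)) (h₃.pow_right m).eq
    have e2 : ContinuousLinearMap.adjoint T (S y) = V' (S (ContinuousLinearMap.adjoint T y)) :=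
      congrArg (fun L : H →L[ℂ] H => L y) h₄
    rw [e1, e2, hy, map_zero, map_zero, map_zero]

end WoldDecomposition

/-! ### Multi-indices and extended indices in `ℕ∞` -/

section MultiIndex

variable {n : ℕ}

/-- Extension of `f ∘ k`, for a multi-index `k` on `A`, by a constant value. -/
def extendIndex {β : Type*} (A : Finset (Fin n)) (k : A → ℕ) (f : ℕ → β) (b : β) (i : Fin n) : β :=
  if h : i ∈ A then f (k ⟨i, h⟩) else b

theorem extendIndex_of_mem {β : Type*} {A : Finset (Fin n)} (k : A → ℕ) (f : ℕ → β) (b : β)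
    {i : Fin n} (h : i ∈ A) : extendIndex A k f b i = f (k ⟨i, h⟩) := dif_pos h

theorem extendIndex_of_notMem {β : Type*} {A : Finset (Fin n)} (k : A → ℕ) (f : ℕ → β) (b : β)
    {i : Fin n} (h : i ∉ A) : extendIndex A k f b i = b := dif_neg h

/-- The index of a joint Wold component: `k` on `A` and `∞` off `A`. -/
abbrev woldIndex (A : Finset (Fin n)) (k : A → ℕ) : Fin n → ℕ∞ := extendIndex A k Nat.cast ⊤

theorem woldIndex_injective {A B : Finset (Fin n)} {k : A → ℕ} {l : B → ℕ}
    (h : woldIndex A k = woldIndex B l) : (⟨A, k⟩ : Σ A : Finset (Fin n), A → ℕ) = ⟨B, l⟩ := by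
  have hAB : A = B := by
    ext i
    have hi := congrFun h i
    by_cases hA : i ∈ A <;> by_cases hB : i ∈ B <;>
      simp_all [woldIndex, extendIndex_of_mem, extendIndex_of_notMem]
  subst hAB
  congr 1
  funext i
  have hi := congrFun h i
  rw [woldIndex, woldIndex, extendIndex_of_mem _ _ _ i.2, extendIndex_of_mem _ _ _ i.2] at hi
  exact_mod_cast hi

theorem exists_woldIndex_eq (α : Fin n → ℕ∞) : ∃ A k, woldIndex A k = α := by
  classical
  refine ⟨Finset.univ.filter fun i => α i ≠ ⊤, fun i => (α i).toNat, funext fun i => ?_⟩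
  by_cases h : α i = ⊤
  · rw [woldIndex, extendIndex_of_notMem _ _ _ (by simp [h]), h]
  · rw [woldIndex, extendIndex_of_mem _ _ _ (by simp [h])]
    exact ENat.natCast_toNat h

theorem woldIndex_add_single_of_mem {A : Finset (Fin n)} (k : A → ℕ) (i : A) :
    woldIndex A k + Pi.single (i : Fin n) 1 = woldIndex A (k + Pi.single i 1) := by
  funext j
  rw [Pi.add_apply]
  by_cases hj : j ∈ A
  · rw [woldIndex, woldIndex, extendIndex_of_mem _ _ _ hj, extendIndex_of_mem _ _ _ hj,
      Pi.add_apply, Nat.cast_add]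
    rcases eq_or_ne j i with rfl | hji
    · simp
    · rw [Pi.single_eq_of_ne hji, Pi.single_eq_of_ne fun h => hji (congrArg Subtype.val h),
        Nat.cast_zero]
  · rw [woldIndex, woldIndex, extendIndex_of_notMem _ _ _ hj, extendIndex_of_notMem _ _ _ hj,
      top_add]

/-- Off `A` the index is `∞`, which absorbs the shift; this is why `T s` with `s ∉ A` acts within
each `T_A ^ k D_A`. -/
theorem woldIndex_add_single_of_notMem {A : Finset (Fin n)} (k : A → ℕ) {s : Fin n} (hs : s ∉ A) :
    woldIndex A k + Pi.single s 1 = woldIndex A k := by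
  funext j
  rw [Pi.add_apply]
  rcases eq_or_ne j s with rfl | hjs
  · rw [woldIndex, extendIndex_of_notMem _ _ _ hs, top_add]
  · rw [Pi.single_eq_of_ne hjs, add_zero]

variable {H : Type*} [NormedAddCommGroup H] [InnerProductSpace ℂ H]

theorem tuplePow_eq_prod_pow (T : Fin n → H →L[ℂ] H) (A : Finset (Fin n)) (k : A → ℕ) :
    tuplePow T A k = ((List.finRange n).map fun i => T i ^ extendIndex A k id 0 i).prod := by
  rw [tuplePow]
  congr 2
  funext i
  unfold extendIndex
  split_ifs <;> simp

theorem tuplePow_zero (T : Fin n → H →L[ℂ] H) (A : Finset (Fin n)) : tuplePow T A 0 = 1 := by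
  rw [tuplePow]
  refine List.prod_eq_one fun S hS => ?_
  obtain ⟨i, -, rfl⟩ := List.mem_map.1 hS
  split_ifs <;> simp

theorem tuplePow_single (T : Fin n → H →L[ℂ] H) (A : Finset (Fin n)) (i : A) (m : ℕ) :
    tuplePow T A (Pi.single i m) = T i ^ m := by
  rw [tuplePow, List.prod_map_eq_pow_single (i : Fin n),
    List.count_eq_one_of_mem (List.nodup_finRange n) (List.mem_finRange _), pow_one]
  · rw [dif_pos i.2, Pi.single_eq_same]
  · intro j hj _
    split_ifs with h
    · rw [Pi.single_eq_of_ne fun h => hj (congrArg Subtype.val h), pow_zero]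
    · rfl

end MultiIndex

/-! ### Doubly twisted tuples and their joint Wold components -/

section DoublyTwisted

variable {H : Type*} [NormedAddCommGroup H] [InnerProductSpace ℂ H] [CompleteSpace H]
  {n : ℕ} {T : Fin n → H →L[ℂ] H} {U : Fin n → Fin n → H →L[ℂ] H}

namespace IsDoublyTwistedNearIsometry

theorem commute_star_unitary (hT : IsDoublyTwistedNearIsometry T U) {i j : Fin n} (h : i < j)
    (k : Fin n) : Commute (T k) (star (U i j)) := by
  have hu := hT.unitary i j h
  have hc : T k * U i j = U i j * T k := hT.mul_unitary i j k h
  change T k * star (U i j) = star (U i j) * T k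
  calc T k * star (U i j) = star (U i j) * U i j * T k * star (U i j) := by
        rw [Unitary.star_mul_self_of_mem hu, one_mul]
    _ = star (U i j) * (T k * U i j) * star (U i j) := by rw [hc]; simp only [mul_assoc]
    _ = star (U i j) * T k := by
        simp only [mul_assoc, Unitary.mul_star_self_of_mem hu, mul_one]

/-- The twisted commutation relations, in a form symmetric in the two indices. -/
theorem exists_twist (hT : IsDoublyTwistedNearIsometry T U) {i j : Fin n} (hij : i ≠ j) :
    ∃ V : H →L[ℂ] H, (∀ k, Commute (T k) V) ∧ (∀ k, Commute (T k) (star V)) ∧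
      T j * T i = V * T i * T j ∧ star (T i) * T j = V * T j * star (T i) := by
  rcases lt_or_gt_of_ne hij with h | h
  · have hu := hT.unitary i j h
    -- The twist is `U i j*` when `i < j` and `U j i` when `j < i`; in the latter case the second
    -- relation is obtained by taking adjoints.
    refine ⟨star (U i j), hT.commute_star_unitary h, fun k => ?_, ?_, ?_⟩
    · rw [star_star]; exact hT.mul_unitary i j k h
    · rw [mul_assoc, hT.mul_mul i j h, ← mul_assoc, ← mul_assoc,
        Unitary.star_mul_self_of_mem hu, one_mul]
    · exact hT.adjoint_mul i j h
  · refine ⟨U j i, fun k => hT.mul_unitary j i k h, hT.commute_star_unitary h, ?_, ?_⟩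
    · exact hT.mul_mul j i h
    · have h1 : star (T j) * T i = star (U j i) * T i * star (T j) := hT.adjoint_mul j i h
      have h2 := congrArg star h1
      simp only [star_mul, star_star] at h2
      have h3 : Commute (star (T i)) (U j i) := by
        have := (hT.commute_star_unitary h i).star_star
        rwa [star_star] at this
      have h4 : Commute (T j) (U j i) := hT.mul_unitary j i j h
      rw [h2, h3.eq, ← mul_assoc, h4.eq]

theorem map_mem_woldComponent (hT : IsDoublyTwistedNearIsometry T U) {i j : Fin n} (hij : i ≠ j)
    {α : ℕ∞} {x : H} (hx : x ∈ woldComponent (T i) α) : T j x ∈ woldComponent (T i) α := by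
  obtain ⟨V, hV, hV', h1, h2⟩ := hT.exists_twist hij
  exact map_mem_woldComponent_of_twisted h1 (hV i)
    (by have := (hV' i).star_star; rwa [star_star] at this) h2 hx

theorem adjoint_map_mem_woldComponent (hT : IsDoublyTwistedNearIsometry T U) {i j : Fin n}
    (hij : i ≠ j) {α : ℕ∞} {x : H} (hx : x ∈ woldComponent (T i) α) :
    ContinuousLinearMap.adjoint (T j) x ∈ woldComponent (T i) α := by
  obtain ⟨V, hV, hV', h1, h2⟩ := hT.exists_twist hij
  -- Taking adjoints exchanges the roles of the two relations: the one for `T i* T j` yields the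
  -- commutation of `T j*` with `T i`, and the one for `T j T i` yields that with `T i*`.
  refine map_mem_woldComponent_of_twisted (V := star V) (V' := star V) ?_ (hV' i)
    ((hV i).star_star) ?_ hx
  · have := congrArg star h2
    simp only [star_mul, star_star] at this
    change star (T j) * T i = _
    rw [this, (hV j).star_star.eq, ← mul_assoc, (hV' i).eq]; rfl
  · have := congrArg star h1
    simp only [star_mul] at this
    change star (T i) * star (T j) = star V * star (T j) * star (T i)
    rw [this, ← mul_assoc, ((hV j).star_star.mul_left (hV i).star_star).eq, mul_assoc]

/-- The component reduces `T j`. If `T j x` lies in it, then `T j` sends the orthogonal part of `x`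
into both the component and its complement, hence to `0`, and `T j` is injective. -/
theorem map_mem_woldComponent_iff (hT : IsDoublyTwistedNearIsometry T U) {i j : Fin n}
    (hij : i ≠ j) {α : ℕ∞} {x : H} :
    T j x ∈ woldComponent (T i) α ↔ x ∈ woldComponent (T i) α := by
  refine ⟨fun h => ?_, hT.map_mem_woldComponent hij⟩
  have : CompleteSpace (woldComponent (T i) α) :=
    ((hT.nearIsometry i).isBoundedBelow.isClosed_woldComponent α).completeSpace_coe
  obtain ⟨p, hp, q, hq, rfl⟩ := (woldComponent (T i) α).exists_add_mem_mem_orthogonal x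
  have hTq : T j q ∈ (woldComponent (T i) α)ᗮ := fun y hy => by
    rw [← ContinuousLinearMap.adjoint_inner_left]
    exact hq _ (hT.adjoint_map_mem_woldComponent hij hy)
  rw [map_add] at h
  have hTq' : T j q ∈ woldComponent (T i) α :=
    (Submodule.add_mem_iff_right _ (hT.map_mem_woldComponent hij hp)).1 h
  have h0 : T j q = 0 := inner_self_eq_zero.1 (hTq _ hTq')
  rw [(hT.nearIsometry j).isBoundedBelow.injective (h0.trans (map_zero _).symm), add_zero]
  exact hp

/-- The projection onto a Wold component of `T i` leaves the Wold components of `T j` invariant. -/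
theorem mem_woldComponent_of_add_eq (hT : IsDoublyTwistedNearIsometry T U) {i j : Fin n}
    (hij : i ≠ j) {α β : ℕ∞} {p q : H} (hp : p ∈ woldComponent (T i) α)
    (hq : q ∈ (woldComponent (T i) α)ᗮ) (h : p + q ∈ woldComponent (T j) β) :
    p ∈ woldComponent (T j) β := by
  have hTq : ∀ {q}, q ∈ (woldComponent (T i) α)ᗮ → T j q ∈ (woldComponent (T i) α)ᗮ :=
    fun hq y hy => by
      rw [← ContinuousLinearMap.adjoint_inner_left]
      exact hq _ (hT.adjoint_map_mem_woldComponent hij hy)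
  have hTq' : ∀ {q}, q ∈ (woldComponent (T i) α)ᗮ →
      ContinuousLinearMap.adjoint (T j) q ∈ (woldComponent (T i) α)ᗮ :=
    fun hq y hy => by
      rw [ContinuousLinearMap.adjoint_inner_right]
      exact hq _ (hT.map_mem_woldComponent hij hy)
  have hpow : ∀ m : ℕ, ∀ p ∈ woldComponent (T i) α, ∀ q ∈ (woldComponent (T i) α)ᗮ,
      (T j ^ m) p ∈ woldComponent (T i) α ∧ (T j ^ m) q ∈ (woldComponent (T i) α)ᗮ := by
    intro m
    induction m with
    | zero => exact fun p hp q hq => ⟨hp, hq⟩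
    | succ m ih =>
      intro p hp q hq
      rw [pow_succ_apply, pow_succ_apply]
      exact ih _ (hT.map_mem_woldComponent hij hp) _ (hTq hq)
  have huniq : ∀ {a b c d : H}, a ∈ woldComponent (T i) α → b ∈ (woldComponent (T i) α)ᗮ →
      c ∈ woldComponent (T i) α → d ∈ (woldComponent (T i) α)ᗮ → a + b = c + d → a = c := by
    intro a b c d ha hb hc hd h
    have h1 : a - c ∈ woldComponent (T i) α := Submodule.sub_mem _ ha hc
    have h2 : a - c ∈ (woldComponent (T i) α)ᗮ := by
      rw [show a - c = d - b by rw [sub_eq_sub_iff_add_eq_add, h, add_comm]]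
      exact Submodule.sub_mem _ hd hb
    exact sub_eq_zero.1 (inner_self_eq_zero.1 (h2 _ h1))
  have : CompleteSpace (woldComponent (T i) α) :=
    ((hT.nearIsometry i).isBoundedBelow.isClosed_woldComponent α).completeSpace_coe
  -- As `T j ^ m` respects the splitting, projecting a preimage of `p + q` gives a preimage of `p`.
  have hpre : ∀ m y, (T j ^ m) y = p + q → ∃ a ∈ woldComponent (T i) α,
      ∃ b ∈ (woldComponent (T i) α)ᗮ, y = a + b ∧ (T j ^ m) a = p := by
    intro m y hy
    obtain ⟨a, ha, b, hb, rfl⟩ := (woldComponent (T i) α).exists_add_mem_mem_orthogonal y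
    refine ⟨a, ha, b, hb, rfl, ?_⟩
    rw [map_add] at hy
    exact huniq (hpow m a ha b hb).1 (hpow m a ha b hb).2 hp hq hy
  induction β with
  | top =>
    rw [mem_woldComponent_top] at h ⊢
    intro m
    obtain ⟨y, hy⟩ := h m
    obtain ⟨a, -, -, -, -, h⟩ := hpre m y hy
    exact ⟨a, h⟩
  | coe m =>
    rw [mem_woldComponent_coe] at h ⊢
    obtain ⟨y, hy0, hy⟩ := h
    obtain ⟨a, ha, b, hb, rfl, h⟩ := hpre m y hy
    refine ⟨a, ?_, h⟩
    rw [map_add] at hy0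
    -- `T j*` also respects the splitting, so `T j* a + T j* b = 0 + 0` forces `T j* a = 0`.
    exact huniq (hT.adjoint_map_mem_woldComponent hij ha) (hTq' hb) (Submodule.zero_mem _)
      (Submodule.zero_mem _) (hy0.trans (add_zero _).symm)

end IsDoublyTwistedNearIsometry

/-- The joint Wold component `⋂ᵢ E_{i, αᵢ}` of a tuple. -/
noncomputable def jointWoldComponent (T : Fin n → H →L[ℂ] H) (α : Fin n → ℕ∞) : Submodule ℂ H :=
  ⨅ i, woldComponent (T i) (α i)

theorem mem_jointWoldComponent {α : Fin n → ℕ∞} {x : H} :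
    x ∈ jointWoldComponent T α ↔ ∀ i, x ∈ woldComponent (T i) (α i) := by
  simp [jointWoldComponent]

namespace IsDoublyTwistedNearIsometry

theorem isClosed_jointWoldComponent (hT : IsDoublyTwistedNearIsometry T U) (α : Fin n → ℕ∞) :
    IsClosed (jointWoldComponent T α : Set H) := by
  rw [jointWoldComponent, Submodule.coe_iInf]
  exact isClosed_iInter fun i => (hT.nearIsometry i).isBoundedBelow.isClosed_woldComponent _

theorem jointWoldComponent_orthogonal (hT : IsDoublyTwistedNearIsometry T U) {α β : Fin n → ℕ∞}
    (h : α ≠ β) {x y : H} (hx : x ∈ jointWoldComponent T α) (hy : y ∈ jointWoldComponent T β) :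
    ⟪x, y⟫_ℂ = 0 := by
  obtain ⟨i, hi⟩ := Function.ne_iff.1 h
  exact (hT.nearIsometry i).woldComponent_orthogonal hi (mem_jointWoldComponent.1 hx i)
    (mem_jointWoldComponent.1 hy i)

/-- The joint Wold components span a dense subspace. -/
theorem eq_zero_of_forall_jointWoldComponent (hT : IsDoublyTwistedNearIsometry T U) {x : H}
    (hx : ∀ α, ∀ y ∈ jointWoldComponent T α, ⟪y, x⟫_ℂ = 0) : x = 0 := by
  by_contra hne
  -- A nonzero vector orthogonal to all joint components is projected onto one component of each `T
  -- j` in turn. At the end it lies in a joint component, so is orthogonal to itself.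
  have key : ∀ s : Finset (Fin n), ∃ (α : Fin n → ℕ∞) (y : H), y ≠ 0 ∧
      (∀ i ∈ s, y ∈ woldComponent (T i) (α i)) ∧
      ∀ β, ∀ z ∈ jointWoldComponent T β, ⟪z, y⟫_ℂ = 0 := by
    intro s
    induction s using Finset.induction_on with
    | empty => exact ⟨0, x, hne, by simp, hx⟩
    | insert j s hj ih =>
      obtain ⟨α, y, hy0, hy, hyz⟩ := ih
      obtain ⟨a, w, hw, hwy⟩ : ∃ a, ∃ w ∈ woldComponent (T j) a, ⟪w, y⟫_ℂ ≠ 0 := by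
        by_contra! hcon
        exact hy0 ((hT.nearIsometry j).eq_zero_of_forall_woldComponent hcon)
      have : CompleteSpace (woldComponent (T j) a) :=
        ((hT.nearIsometry j).isBoundedBelow.isClosed_woldComponent a).completeSpace_coe
      obtain ⟨p, hp, q, hq, rfl⟩ := (woldComponent (T j) a).exists_add_mem_mem_orthogonal y
      refine ⟨Function.update α j a, p, ?_, fun i hi => ?_, fun β z hz => ?_⟩
      · rintro rfl
        rw [zero_add] at hwy
        exact hwy (hq w hw)
      · rcases eq_or_ne i j with rfl | hij
        · simpa using hp
        · rw [Function.update_of_ne hij]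
          exact hT.mem_woldComponent_of_add_eq hij.symm hp hq
            (hy i (Finset.mem_of_mem_insert_of_ne hi hij))
      -- A joint component lies inside the chosen component of `T j`, where `q` contributes nothing,
      -- or is orthogonal to it and hence to `p`.
      · by_cases hβ : β j = a
        · have hzj : z ∈ woldComponent (T j) a := hβ ▸ mem_jointWoldComponent.1 hz j
          have h0 := hyz β z hz
          rwa [inner_add_right, hq z hzj, add_zero] at h0
        · exact (hT.nearIsometry j).woldComponent_orthogonal hβ
            (mem_jointWoldComponent.1 hz j) hp
  obtain ⟨α, y, hy0, hy, hyz⟩ := key Finset.univ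
  exact hy0 (inner_self_eq_zero.1
    (hyz α y (mem_jointWoldComponent.2 fun i => hy i (Finset.mem_univ i))))

theorem map_jointWoldComponent (hT : IsDoublyTwistedNearIsometry T U) (i : Fin n)
    (α : Fin n → ℕ∞) : imageSubspace (T i) (jointWoldComponent T α) =
      jointWoldComponent T (α + Pi.single i 1) := by
  have key : ∀ y, T i y ∈ jointWoldComponent T (α + Pi.single i 1) ↔
      y ∈ jointWoldComponent T α := by
    intro y
    rw [mem_jointWoldComponent, mem_jointWoldComponent]
    refine forall_congr' fun j => ?_
    rcases eq_or_ne j i with rfl | hj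
    · rw [Pi.add_apply, Pi.single_eq_same]
      exact (hT.nearIsometry j).isBoundedBelow.map_mem_woldComponent_iff
    · rw [Pi.add_apply, Pi.single_eq_of_ne hj, add_zero]
      exact hT.map_mem_woldComponent_iff hj
  ext x
  refine ⟨?_, fun hx => ?_⟩
  · rintro ⟨y, hy, rfl⟩
    exact (key y).2 hy
  · obtain ⟨y, rfl⟩ := exists_map_eq_of_mem_woldComponent_add_one (T := T i) (α := α i) (x := x) (by
      simpa using mem_jointWoldComponent.1 hx i)
    exact ⟨y, (key y).1 hx, rfl⟩

theorem map_pow_jointWoldComponent (hT : IsDoublyTwistedNearIsometry T U) (i : Fin n) (m : ℕ)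
    (α : Fin n → ℕ∞) : imageSubspace (T i ^ m) (jointWoldComponent T α) =
      jointWoldComponent T (α + Pi.single i (m : ℕ∞)) := by
  induction m generalizing α with
  | zero =>
    rw [Nat.cast_zero, Pi.single_zero, add_zero]
    exact Submodule.map_id _
  | succ m ih =>
    have : imageSubspace (T i ^ (m + 1)) (jointWoldComponent T α) =
        imageSubspace (T i ^ m) (imageSubspace (T i) (jointWoldComponent T α)) := by
      rw [pow_succ]
      exact Submodule.map_comp _ _ _
    rw [this, hT.map_jointWoldComponent, ih, add_assoc, ← Pi.single_add, Nat.cast_succ, add_comm 1]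

theorem map_list_prod_jointWoldComponent (hT : IsDoublyTwistedNearIsometry T U) (g : Fin n → ℕ)
    (l : List (Fin n)) (α : Fin n → ℕ∞) :
    imageSubspace (l.map fun i => T i ^ g i).prod (jointWoldComponent T α) =
      jointWoldComponent T (α + (l.map fun i => Pi.single i (g i : ℕ∞)).sum) := by
  induction l with
  | nil =>
    rw [List.map_nil, List.map_nil, List.sum_nil, add_zero]
    exact Submodule.map_id _
  | cons i l ih =>
    simp only [List.map_cons, List.prod_cons, List.sum_cons]
    have : imageSubspace (T i ^ g i * (l.map fun i => T i ^ g i).prod) (jointWoldComponent T α) =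
        imageSubspace (T i ^ g i)
          (imageSubspace (l.map fun i => T i ^ g i).prod (jointWoldComponent T α)) :=
      Submodule.map_comp _ _ _
    rw [this, ih, hT.map_pow_jointWoldComponent, add_assoc, add_comm (List.sum _)]

end IsDoublyTwistedNearIsometry

theorem mem_kernelSubspace {A : Finset (Fin n)} {x : H} :
    x ∈ kernelSubspace T A ↔ ∀ i ∈ A, ContinuousLinearMap.adjoint (T i) x = 0 := by
  simp [kernelSubspace, Submodule.mem_iInf]

namespace IsDoublyTwistedNearIsometry

theorem map_tuplePow_jointWoldComponent (hT : IsDoublyTwistedNearIsometry T U)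
    (A : Finset (Fin n)) (k : A → ℕ) (α : Fin n → ℕ∞) :
    imageSubspace (tuplePow T A k) (jointWoldComponent T α) =
      jointWoldComponent T (α + fun i => ((extendIndex A k id 0 i : ℕ) : ℕ∞)) := by
  rw [tuplePow_eq_prod_pow, hT.map_list_prod_jointWoldComponent, ← Fin.sum_univ_def,
    Finset.univ_sum_single fun i => ((extendIndex A k id 0 i : ℕ) : ℕ∞)]

/-- On the component of index `(A, 0)` the powers `T_{Aᶜ} ^ l` only shift infinite entries, so they
map it onto itself; this places it in `D_A`. Conversely, `l = 0` gives the conditions on `A` and `l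
= m e_i` those at `i ∉ A`. -/
theorem wanderingSubspace_eq (hT : IsDoublyTwistedNearIsometry T U) (A : Finset (Fin n)) :
    wanderingSubspace T A = jointWoldComponent T (woldIndex A 0) := by
  refine le_antisymm (fun x hx => ?_) (le_iInf fun l => ?_)
  · rw [wanderingSubspace, Submodule.mem_iInf] at hx
    refine mem_jointWoldComponent.2 fun i => ?_
    by_cases hi : i ∈ A
    · rw [woldIndex, extendIndex_of_mem _ _ _ hi]
      obtain ⟨y, hy, rfl⟩ := hx 0
      rw [tuplePow_zero]
      exact mem_woldComponent_coe.2 ⟨y, mem_kernelSubspace.1 hy i hi, rfl⟩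
    · rw [woldIndex, extendIndex_of_notMem _ _ _ hi, mem_woldComponent_top]
      intro m
      obtain ⟨y, -, rfl⟩ := hx (Pi.single ⟨i, Finset.mem_compl.2 hi⟩ m)
      rw [tuplePow_single]
      exact ⟨y, rfl⟩
  · have hfix : (woldIndex A 0 + fun i => ((extendIndex Aᶜ l id 0 i : ℕ) : ℕ∞)) = woldIndex A 0 := by
      funext i
      rw [Pi.add_apply]
      by_cases hi : i ∈ A
      · rw [extendIndex_of_notMem l _ _ (by simpa using hi), Nat.cast_zero, add_zero]
      · rw [woldIndex, extendIndex_of_notMem _ _ _ hi, top_add]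
    rw [← hfix, ← hT.map_tuplePow_jointWoldComponent]
    refine Submodule.map_mono fun x hx => mem_kernelSubspace.2 fun i hi => ?_
    have hxi := mem_jointWoldComponent.1 hx i
    rw [woldIndex, extendIndex_of_mem _ _ _ hi, mem_woldComponent_coe] at hxi
    obtain ⟨y, hy, rfl⟩ := hxi
    exact hy

theorem map_tuplePow_wanderingSubspace (hT : IsDoublyTwistedNearIsometry T U)
    (A : Finset (Fin n)) (k : A → ℕ) :
    imageSubspace (tuplePow T A k) (wanderingSubspace T A) =
      jointWoldComponent T (woldIndex A k) := by
  rw [hT.wanderingSubspace_eq, hT.map_tuplePow_jointWoldComponent]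
  congr 1
  funext i
  rw [Pi.add_apply]
  by_cases hi : i ∈ A
  · simp [woldIndex, extendIndex_of_mem _ _ _ hi]
  · rw [woldIndex, woldIndex, extendIndex_of_notMem 0 _ _ hi, extendIndex_of_notMem k Nat.cast _ hi,
      top_add]

theorem isBoundedBelow_tuplePow (hT : IsDoublyTwistedNearIsometry T U) (A : Finset (Fin n))
    (k : A → ℕ) : IsBoundedBelow (tuplePow T A k) := by
  rw [tuplePow_eq_prod_pow]
  refine .list_prod fun S hS => ?_
  obtain ⟨i, -, rfl⟩ := List.mem_map.1 hS
  exact (hT.nearIsometry i).isBoundedBelow.pow _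

theorem completeSpace_wanderingSubspace (hT : IsDoublyTwistedNearIsometry T U)
    (A : Finset (Fin n)) : CompleteSpace (wanderingSubspace T A) := by
  rw [hT.wanderingSubspace_eq]
  exact (hT.isClosed_jointWoldComponent _).completeSpace_coe

theorem map_mem_of_mem (hT : IsDoublyTwistedNearIsometry T U) {A : Finset (Fin n)} (k : A → ℕ)
    (i : A) {x : H} (hx : x ∈ imageSubspace (tuplePow T A k) (wanderingSubspace T A)) :
    T i x ∈ imageSubspace (tuplePow T A (k + Pi.single i 1)) (wanderingSubspace T A) := by
  rw [hT.map_tuplePow_wanderingSubspace] at hx ⊢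
  rw [← woldIndex_add_single_of_mem, ← hT.map_jointWoldComponent]
  exact ⟨x, hx, rfl⟩

theorem map_mem_of_notMem (hT : IsDoublyTwistedNearIsometry T U) {A : Finset (Fin n)} (k : A → ℕ)
    {s : Fin n} (hs : s ∉ A) {x : H}
    (hx : x ∈ imageSubspace (tuplePow T A k) (wanderingSubspace T A)) :
    T s x ∈ imageSubspace (tuplePow T A k) (wanderingSubspace T A) := by
  rw [hT.map_tuplePow_wanderingSubspace] at hx ⊢
  rw [← woldIndex_add_single_of_notMem k hs, ← hT.map_jointWoldComponent]
  exact ⟨x, hx, rfl⟩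

end IsDoublyTwistedNearIsometry

end DoublyTwisted

/-! ### Hardy space as a space of square-summable coefficients -/

section Hardy

variable {ι : Type*} [Fintype ι] {E : Type*} [NormedAddCommGroup E] [InnerProductSpace ℂ E]

theorem summable_norm_multiPow (z : Polydisc ι) : Summable fun k => ‖multiPow k z.1‖ := by
  classical
  refine summable_of_sum_le (c := ∏ i, ∑' j : ℕ, ‖z.1 i‖ ^ j) (fun _ => norm_nonneg _)
    fun s => ?_
  have hgeom : ∀ i, Summable fun j : ℕ => ‖z.1 i‖ ^ j := fun i =>
    summable_geometric_of_lt_one (norm_nonneg _) (z.2 i)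
  -- The finite set is enclosed in a box, over which the sum factors into partial geometric series.
  calc ∑ k ∈ s, ‖multiPow k z.1‖
      ≤ ∑ k ∈ Fintype.piFinset fun i => s.image fun k => k i, ‖multiPow k z.1‖ :=
        Finset.sum_le_sum_of_subset_of_nonneg
          (fun k hk => Fintype.mem_piFinset.2 fun i => Finset.mem_image_of_mem _ hk)
          fun _ _ _ => norm_nonneg _
    _ = ∏ i, ∑ j ∈ s.image fun k => k i, ‖z.1 i‖ ^ j := by
        rw [Finset.prod_univ_sum]
        simp [multiPow]
    _ ≤ ∏ i, ∑' j : ℕ, ‖z.1 i‖ ^ j :=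
        Finset.prod_le_prod (fun i _ => Finset.sum_nonneg fun _ _ => by positivity)
          fun i _ => (hgeom i).sum_le_tsum _ fun _ _ => by positivity

namespace HardySpace

theorem coeff_eq_of_hasSum {f : HardySpace ι E} {c : lp (fun _ : ι → ℕ => E) 2}
    (h : ∀ z : Polydisc ι, HasSum (fun k => multiPow k z.1 • c k) (f z)) : coeff f = c :=
  Subtype.ext <| coeff_unique f.hasSum_coeff h

theorem coeff_surjective [CompleteSpace E] :
    Function.Surjective (coeff : HardySpace ι E →ₗ[ℂ] lp (fun _ : ι → ℕ => E) 2) := by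
  intro c
  have hs : ∀ z : Polydisc ι, Summable fun k => multiPow k z.1 • c k := fun z => by
    refine .of_norm_bounded ((summable_norm_multiPow z).mul_right ‖c‖) fun k => ?_
    rw [norm_smul]
    gcongr
    exact lp.norm_apply_le_norm (by simp) c k
  exact ⟨⟨fun z => ∑' k, multiPow k z.1 • c k, c, fun z => (hs z).hasSum⟩,
    coeff_eq_of_hasSum fun z => (hs z).hasSum⟩

/-- A function in the Hardy space is determined by its square summable coefficients. -/
noncomputable def coeffEquiv [CompleteSpace E] :
    HardySpace ι E ≃ₗᵢ[ℂ] lp (fun _ : ι → ℕ => E) 2 where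
  toLinearEquiv := .ofBijective coeff ⟨coeff_injective, coeff_surjective⟩
  norm_map' _ := rfl

instance [CompleteSpace E] : CompleteSpace (HardySpace ι E) :=
  (coeffEquiv (ι := ι) (E := E)).toIsometryEquiv.completeSpace

theorem coeff_monomial [DecidableEq (ι → ℕ)] (k : ι → ℕ) (η : E) :
    coeff (monomial k η : HardySpace ι E) = lp.single 2 k η := by
  refine coeff_eq_of_hasSum fun z => ?_
  change HasSum _ (multiPow k z.1 • η)
  convert hasSum_ite_eq k (multiPow k z.1 • η) using 2 with j
  split_ifs with h
  · subst h; simp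
  · simp [h]

theorem inner_eq_inner_coeff (f g : HardySpace ι E) : ⟪f, g⟫_ℂ = ⟪coeff f, coeff g⟫_ℂ := rfl

theorem inner_monomial_left (k : ι → ℕ) (η : E) (f : HardySpace ι E) :
    ⟪monomial k η, f⟫_ℂ = ⟪η, coeff f k⟫_ℂ := by
  classical
  rw [inner_eq_inner_coeff, coeff_monomial, lp.inner_single_left]

theorem inner_monomial_monomial (k : ι → ℕ) (η ξ : E) :
    ⟪(monomial k η : HardySpace ι E), monomial k ξ⟫_ℂ = ⟪η, ξ⟫_ℂ := by
  classical
  rw [inner_monomial_left, coeff_monomial, lp.single_apply_self]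

theorem inner_monomial_monomial_of_ne {k l : ι → ℕ} (h : k ≠ l) (η ξ : E) :
    ⟪(monomial k η : HardySpace ι E), monomial l ξ⟫_ℂ = 0 := by
  classical
  rw [inner_monomial_left, coeff_monomial, lp.single_apply_ne _ _ _ h, inner_zero_right]

theorem eq_zero_of_forall_inner_monomial {f : HardySpace ι E}
    (h : ∀ k η, ⟪(monomial k η : HardySpace ι E), f⟫_ℂ = 0) : f = 0 := by
  refine coeff_injective (Subtype.ext (funext fun k => ?_))
  rw [map_zero]
  refine ext_inner_left ℂ fun η => ?_
  rw [← inner_monomial_left, h]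
  exact (inner_zero_right _).symm

/-- The isometric embedding `η ↦ zᵏ ⊗ η`. -/
noncomputable def monomialₗᵢ (k : ι → ℕ) : E →ₗᵢ[ℂ] HardySpace ι E :=
  LinearMap.isometryOfInner
    { toFun := monomial k
      map_add' := fun _ _ => Subtype.ext (funext fun _ => smul_add _ _ _)
      map_smul' := fun _ _ => Subtype.ext (funext fun _ => smul_comm _ _ _) }
    (inner_monomial_monomial k)

end HardySpace

/-- The inclusion of a summand in a finite Hilbert space direct sum. -/
noncomputable def piLpSingleₗᵢ {α : Type*} [Fintype α] [DecidableEq α] {G : α → Type*}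
    [∀ a, NormedAddCommGroup (G a)] [∀ a, InnerProductSpace ℂ (G a)] (a : α) :
    G a →ₗᵢ[ℂ] PiLp 2 G where
  toFun := PiLp.single 2 a
  map_add' _ _ := PiLp.single_add 2 a
  map_smul' c x := by
    ext b
    rcases eq_or_ne b a with rfl | h
    · simp
    · simp [PiLp.single_eq_of_ne 2 h]
  norm_map' x := by simp

theorem inner_piLp_single_left {α : Type*} [Fintype α] [DecidableEq α] {G : α → Type*}
    [∀ a, NormedAddCommGroup (G a)] [∀ a, InnerProductSpace ℂ (G a)] (a : α) (x : G a)
    (f : PiLp 2 G) : ⟪(PiLp.single 2 a x : PiLp 2 G), f⟫_ℂ = ⟪x, f a⟫_ℂ := by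
  rw [PiLp.inner_apply, Finset.sum_eq_single a]
  · simp
  · intro b _ hb
    simp [PiLp.single_eq_of_ne 2 hb]
  · simp

end Hardy

/-! ### Polar decomposition of an operator bounded below -/

section Polar

variable {H : Type*} [NormedAddCommGroup H] [InnerProductSpace ℂ H]

theorem ContinuousLinearMap.IsPositive.exists_sqrt {E : Type*} [NormedAddCommGroup E]
    [InnerProductSpace ℂ E] [CompleteSpace E] {Q : E →L[ℂ] E} (hQ : Q.IsPositive) :
    ∃ P : E →L[ℂ] E, P.IsPositive ∧ P * P = Q := by
  rw [← ContinuousLinearMap.nonneg_iff_isPositive] at hQ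
  exact ⟨CFC.sqrt Q, (ContinuousLinearMap.nonneg_iff_isPositive _).1 (CFC.sqrt_nonneg Q),
    CFC.sqrt_mul_sqrt_self Q hQ⟩

/-- An operator bounded below has a unitary polar factor on every complete subspace. -/
theorem exists_isPolarUnitary [CompleteSpace H] {L : H →L[ℂ] H} {δ : ℝ} (hδ : 0 < δ)
    (hL : ∀ x, δ * ‖x‖ ≤ ‖L x‖) (D : Submodule ℂ H) [CompleteSpace D] :
    ∃ Λ : D ≃ₗᵢ[ℂ] imageSubspace L D, IsPolarUnitary L D Λ := by
  have hinj : Function.Injective L := by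
    refine (injective_iff_map_eq_zero L).2 fun x hx => ?_
    have := hL x
    rw [hx, norm_zero] at this
    exact norm_le_zero_iff.1 (nonpos_of_mul_nonpos_right this hδ)
  let S : D →L[ℂ] H := L ∘L D.subtypeL
  let Q : D →L[ℂ] D := ContinuousLinearMap.adjoint S ∘L S
  -- `P = |S|`, so `‖P x‖ = ‖L x‖`: `P` is bounded below and self-adjoint, hence bijective, and the
  -- unitary factor is `L P⁻¹`.
  obtain ⟨P, hP, hPP⟩ : ∃ P : D →L[ℂ] D, P.IsPositive ∧ P * P = Q :=
    (ContinuousLinearMap.isPositive_adjoint_comp_self S).exists_sqrt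
  have hPadj : ContinuousLinearMap.adjoint P = P := hP.isSelfAdjoint.adjoint_eq
  have hnorm : ∀ x, ‖P x‖ = ‖L x‖ := by
    intro x
    have h1 : ⟪P x, P x⟫_ℂ = ⟪S x, S x⟫_ℂ := by
      calc ⟪P x, P x⟫_ℂ = ⟪(P * P) x, x⟫_ℂ := by
            rw [← ContinuousLinearMap.adjoint_inner_left, hPadj]; rfl
        _ = ⟪S x, S x⟫_ℂ := by
            rw [hPP, ← ContinuousLinearMap.adjoint_inner_left]; rfl
    rw [inner_self_eq_norm_sq_to_K, inner_self_eq_norm_sq_to_K] at h1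
    have h2 : ‖P x‖ ^ 2 = ‖L x‖ ^ 2 := by exact_mod_cast h1
    exact (sq_eq_sq₀ (norm_nonneg _) (norm_nonneg _)).1 h2
  have hbelow : ∀ x, ‖x‖ ≤ δ⁻¹ * ‖P x‖ := fun x => by
    rw [hnorm, inv_mul_eq_div, le_div_iff₀ hδ, mul_comm]
    exact hL x
  have hanti : AntilipschitzWith ⟨δ⁻¹, by positivity⟩ P := P.antilipschitz_of_bound hbelow
  have hsurj : Function.Surjective P := by
    have hcl : IsClosed (P.range : Set D) := by
      have h := hanti.isClosed_range P.uniformContinuous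
      rwa [← ContinuousLinearMap.coe_coe, ← LinearMap.coe_range] at h
    have : CompleteSpace P.range := hcl.completeSpace_coe
    rw [← ContinuousLinearMap.coe_coe, ← LinearMap.range_eq_top, ← Submodule.orthogonal_eq_bot_iff,
      ContinuousLinearMap.orthogonal_range, hPadj, LinearMap.ker_eq_bot]
    exact hanti.injective
  let e : D ≃ₗ[ℂ] D := LinearEquiv.ofBijective (P : D →ₗ[ℂ] D) ⟨hanti.injective, hsurj⟩
  let f : D ≃ₗ[ℂ] imageSubspace L D := Submodule.equivMapOfInjective (L : H →ₗ[ℂ] H) hinj D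
  have he : ∀ x, e x = P x := fun _ => rfl
  have hf : ∀ x, (f x : H) = L x := fun x => rfl
  refine ⟨⟨e.symm.trans f, fun x => ?_⟩, P, hP, fun x => ?_⟩
  · obtain ⟨y, rfl⟩ := e.surjective x
    rw [LinearEquiv.trans_apply, LinearEquiv.symm_apply_apply, Submodule.coe_norm, hf, he, hnorm]
  · change L x = (f (e.symm (P x)) : H)
    rw [← he, LinearEquiv.symm_apply_apply, hf]

end Polar

/-! ### Hilbert sums and operators determined on a total family -/

section HilbertSum

variable {α : Type*} {G : α → Type*} [∀ a, NormedAddCommGroup (G a)]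
  [∀ a, InnerProductSpace ℂ (G a)] {E : Type*} [NormedAddCommGroup E] [InnerProductSpace ℂ E]
  [CompleteSpace E] {E' : Type*} [NormedAddCommGroup E'] [InnerProductSpace ℂ E'] [CompleteSpace E']

theorem isHilbertSum_of_forall_inner_eq_zero [∀ a, CompleteSpace (G a)] {V : ∀ a, G a →ₗᵢ[ℂ] E}
    (hV : OrthogonalFamily ℂ G V) (h : ∀ x, (∀ a y, ⟪V a y, x⟫_ℂ = 0) → x = 0) :
    IsHilbertSum ℂ G V := by
  refine .mk hV (top_le_iff.2 ?_)
  rw [Submodule.topologicalClosure_eq_top_iff, Submodule.eq_bot_iff]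
  exact fun x hx => h x fun a y => hx _ (Submodule.mem_iSup_of_mem a ⟨y, rfl⟩)

theorem IsHilbertSum.exists_linearIsometryEquiv {V : ∀ a, G a →ₗᵢ[ℂ] E} {V' : ∀ a, G a →ₗᵢ[ℂ] E'}
    (hV : IsHilbertSum ℂ G V) (hV' : IsHilbertSum ℂ G V') :
    ∃ W : E ≃ₗᵢ[ℂ] E', ∀ a x, W (V a x) = V' a x := by
  classical
  refine ⟨hV.linearIsometryEquiv.trans hV'.linearIsometryEquiv.symm, fun a x => ?_⟩
  rw [LinearIsometryEquiv.trans_apply, ← hV.linearIsometryEquiv_symm_apply_single,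
    LinearIsometryEquiv.apply_symm_apply, hV'.linearIsometryEquiv_symm_apply_single]

theorem ContinuousLinearMap.ext_of_total {F : Type*} [NormedAddCommGroup F] [NormedSpace ℂ F]
    {V : ∀ a, G a →ₗᵢ[ℂ] E} (hV : ∀ x, (∀ a y, ⟪V a y, x⟫_ℂ = 0) → x = 0) {X Y : E →L[ℂ] F}
    (h : ∀ a x, X (V a x) = Y (V a x)) : X = Y := by
  have htop : (⨆ a, LinearMap.range (V a).toLinearMap).topologicalClosure = ⊤ := by
    rw [Submodule.topologicalClosure_eq_top_iff, Submodule.eq_bot_iff]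
    exact fun x hx => hV x fun a y => hx _ (Submodule.mem_iSup_of_mem a ⟨y, rfl⟩)
  have hle : (⨆ a, LinearMap.range (V a).toLinearMap).topologicalClosure ≤
      LinearMap.eqLocus (X : E →ₗ[ℂ] F) (Y : E →ₗ[ℂ] F) := by
    refine Submodule.topologicalClosure_minimal _ (iSup_le fun a => ?_)
      (isClosed_eq X.continuous Y.continuous)
    rintro - ⟨x, rfl⟩
    exact h a x
  rw [htop] at hle
  exact ContinuousLinearMap.ext fun x => hle (Submodule.mem_top (x := x))

end HilbertSum

/-! ### The model space and block-diagonal operators -/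

section Model

/-- The embedding of a coefficient space as `η ↦ zᵏ ⊗ η` in the summand of index `a` in a direct
sum of Hardy spaces. -/
noncomputable def hardySumMonomial {α : Type*} [Fintype α] [DecidableEq α] {ι : α → Type*}
    [∀ a, Fintype (ι a)] {D : α → Type*} [∀ a, NormedAddCommGroup (D a)]
    [∀ a, InnerProductSpace ℂ (D a)] (p : Σ a, ι a → ℕ) :
    D p.1 →ₗᵢ[ℂ] PiLp 2 fun a => HardySpace (ι a) (D a) :=
  (piLpSingleₗᵢ p.1).comp (HardySpace.monomialₗᵢ p.2)

variable {α : Type*} [Fintype α] [DecidableEq α] {ι : α → Type*}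
  [∀ a, Fintype (ι a)] {D : α → Type*} [∀ a, NormedAddCommGroup (D a)]
  [∀ a, InnerProductSpace ℂ (D a)]

theorem hardySumMonomial_apply (p : Σ a, ι a → ℕ) (η : D p.1) :
    (hardySumMonomial p η : PiLp 2 fun a => HardySpace (ι a) (D a)) =
      PiLp.single 2 p.1 (HardySpace.monomial p.2 η) := rfl

theorem orthogonalFamily_hardySumMonomial :
    OrthogonalFamily ℂ (fun p : Σ a, ι a → ℕ => D p.1) hardySumMonomial := by
  rintro ⟨a, k⟩ ⟨b, l⟩ h η ξ
  rw [hardySumMonomial_apply, hardySumMonomial_apply, inner_piLp_single_left]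
  rcases eq_or_ne a b with rfl | hab
  · rw [PiLp.single_eq_same]
    exact HardySpace.inner_monomial_monomial_of_ne (fun hkl => h (congrArg (Sigma.mk a) hkl)) _ _
  · rw [PiLp.single_eq_of_ne 2 hab, inner_zero_right]

theorem eq_zero_of_forall_inner_hardySumMonomial {f : PiLp 2 fun a => HardySpace (ι a) (D a)}
    (h : ∀ (p : Σ a, ι a → ℕ) (η : D p.1), ⟪hardySumMonomial p η, f⟫_ℂ = 0) : f = 0 := by
  ext a : 1
  refine HardySpace.eq_zero_of_forall_inner_monomial fun k η => ?_
  rw [← h ⟨a, k⟩ η, hardySumMonomial_apply, inner_piLp_single_left]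

/-- The diagonal block of an operator on a finite direct sum. -/
noncomputable def diagonalBlock {G : α → Type*} [∀ a, NormedAddCommGroup (G a)]
    [∀ a, InnerProductSpace ℂ (G a)] (X : PiLp 2 G →L[ℂ] PiLp 2 G) (a : α) : G a →L[ℂ] G a :=
  PiLp.proj 2 G a ∘L X ∘L (piLpSingleₗᵢ a).toContinuousLinearMap

theorem diagonalBlock_apply {G : α → Type*} [∀ a, NormedAddCommGroup (G a)]
    [∀ a, InnerProductSpace ℂ (G a)] (X : PiLp 2 G →L[ℂ] PiLp 2 G) (a : α) (x : G a) :
    diagonalBlock X a x = X (PiLp.single 2 a x) a := rfl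

theorem directSumOperator_single {G : α → Type*} [∀ a, NormedAddCommGroup (G a)]
    [∀ a, InnerProductSpace ℂ (G a)] (M : ∀ a, G a →L[ℂ] G a) (a : α) (x : G a) :
    directSumOperator M (PiLp.single 2 a x) = PiLp.single 2 a (M a x) := by
  ext b : 1
  change M b (PiLp.single 2 a x b) = _
  rcases eq_or_ne b a with rfl | h
  · rw [PiLp.single_eq_same, PiLp.single_eq_same]
  · rw [PiLp.single_eq_of_ne 2 h, PiLp.single_eq_of_ne 2 h, map_zero]

end Model

/-! ### Assembly of the unitary equivalence -/

theorem theorem1 {H : Type*} [NormedAddCommGroup H] [InnerProductSpace ℂ H] [CompleteSpace H]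
    {n : ℕ} (T : Fin n → H →L[ℂ] H) (U : Fin n → Fin n → H →L[ℂ] H)
    (hT : IsDoublyTwistedNearIsometry T U) :
    ∃ Λ : ∀ (A : Finset (Fin n)) (k : A → ℕ),
        wanderingSubspace T A ≃ₗᵢ[ℂ] imageSubspace (tuplePow T A k) (wanderingSubspace T A),
      (∀ A k, IsPolarUnitary (tuplePow T A k) (wanderingSubspace T A) (Λ A k)) ∧
      ∃ (hshift : ∀ (A : Finset (Fin n)) (k : A → ℕ) (i : A) (η : wanderingSubspace T A),
          T i (Λ A k η) ∈
            imageSubspace (tuplePow T A (k + Pi.single i 1)) (wanderingSubspace T A))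
        (hdiag : ∀ (A : Finset (Fin n)) (k : A → ℕ) (s : Fin n), s ∉ A →
          ∀ η : wanderingSubspace T A,
          T s (Λ A k η) ∈ imageSubspace (tuplePow T A k) (wanderingSubspace T A))
        (M : ∀ A : Finset (Fin n), Fin n →
          HardySpace A (wanderingSubspace T A) →L[ℂ] HardySpace A (wanderingSubspace T A)),
        (∀ (A : Finset (Fin n)) (k : A → ℕ) (i : A) (η : wanderingSubspace T A),
          M A i (HardySpace.monomial k η) =
            HardySpace.monomial (k + Pi.single i 1)
              ((Λ A (k + Pi.single i 1)).symm ⟨T i (Λ A k η), hshift A k i η⟩)) ∧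
        (∀ (A : Finset (Fin n)) (k : A → ℕ) (s : Fin n) (hs : s ∉ A)
          (η : wanderingSubspace T A),
          M A s (HardySpace.monomial k η) =
            HardySpace.monomial k ((Λ A k).symm ⟨T s (Λ A k η), hdiag A k s hs η⟩)) ∧
        TupleUnitarilyEquivalent T (fun s => directSumOperator fun A => M A s) := by
  have hcomplete : ∀ A, CompleteSpace (wanderingSubspace T A) := hT.completeSpace_wanderingSubspace
  have hpolar : ∀ A k, ∃ Λ, IsPolarUnitary (tuplePow T A k) (wanderingSubspace T A) Λ := by
    intro A k
    obtain ⟨δ, hδ, h⟩ := hT.isBoundedBelow_tuplePow A k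
    exact exists_isPolarUnitary hδ h _
  choose Λ hΛ using hpolar
  have hshift : ∀ (A : Finset (Fin n)) (k : A → ℕ) (i : A) (η : wanderingSubspace T A),
      T i (Λ A k η) ∈ imageSubspace (tuplePow T A (k + Pi.single i 1)) (wanderingSubspace T A) :=
    fun A k i η => hT.map_mem_of_mem k i (Λ A k η).2
  have hdiag : ∀ (A : Finset (Fin n)) (k : A → ℕ) (s : Fin n), s ∉ A →
      ∀ η : wanderingSubspace T A,
        T s (Λ A k η) ∈ imageSubspace (tuplePow T A k) (wanderingSubspace T A) :=
    fun A k s hs η => hT.map_mem_of_notMem k hs (Λ A k η).2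
  let V : ∀ p : Σ A : Finset (Fin n), A → ℕ, wanderingSubspace T p.1 →ₗᵢ[ℂ] H := fun p =>
    (imageSubspace (tuplePow T p.1 p.2) (wanderingSubspace T p.1)).subtypeₗᵢ.comp
      (Λ p.1 p.2).toLinearIsometry
  have hVmem : ∀ p η, V p η ∈ jointWoldComponent T (woldIndex p.1 p.2) := fun p η => by
    rw [← hT.map_tuplePow_wanderingSubspace]
    exact (Λ p.1 p.2 η).2
  have hVsum : IsHilbertSum ℂ (fun p : Σ A : Finset (Fin n), A → ℕ => wanderingSubspace T p.1) V := by
    refine isHilbertSum_of_forall_inner_eq_zero (fun p q hpq η ξ =>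
      hT.jointWoldComponent_orthogonal (fun h => hpq (woldIndex_injective h)) (hVmem p η)
        (hVmem q ξ)) fun x hx => hT.eq_zero_of_forall_jointWoldComponent fun α y hy => ?_
    obtain ⟨A, k, rfl⟩ := exists_woldIndex_eq α
    rw [← hT.map_tuplePow_wanderingSubspace] at hy
    rw [← hx ⟨A, k⟩ ((Λ A k).symm ⟨y, hy⟩)]
    change _ = ⟪(Λ A k ((Λ A k).symm ⟨y, hy⟩) : H), x⟫_ℂ
    rw [LinearIsometryEquiv.apply_symm_apply]
  obtain ⟨W, hW⟩ := hVsum.exists_linearIsometryEquiv (isHilbertSum_of_forall_inner_eq_zero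
    (orthogonalFamily_hardySumMonomial (ι := fun A : Finset (Fin n) => A)
      (D := fun A => wanderingSubspace T A)) fun _ =>
        eq_zero_of_forall_inner_hardySumMonomial (ι := fun A : Finset (Fin n) => A)
          (D := fun A => wanderingSubspace T A))
  -- Boundedness of the model operators comes for free: they are the diagonal blocks of the
  -- conjugates `W T s W*`.
  let X : Fin n → (PiLp 2 fun A : Finset (Fin n) => HardySpace A (wanderingSubspace T A)) →L[ℂ]
      PiLp 2 fun A : Finset (Fin n) => HardySpace A (wanderingSubspace T A) := fun s =>
    (W : H →L[ℂ] _) ∘L T s ∘L (W.symm : _ →L[ℂ] H)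
  -- The target exponent `l` is left free so that both `l = k + e_i` and `l = k` are covered.
  have hX : ∀ s (A : Finset (Fin n)) (k l : A → ℕ) (η : wanderingSubspace T A)
      (h : T s (Λ A k η) ∈ imageSubspace (tuplePow T A l) (wanderingSubspace T A)),
      X s (PiLp.single 2 A (HardySpace.monomial k η)) =
        PiLp.single 2 A (HardySpace.monomial l ((Λ A l).symm ⟨T s (Λ A k η), h⟩)) := by
    intro s A k l η h
    have h1 := hW ⟨A, k⟩ η
    have h2 := hW ⟨A, l⟩ ((Λ A l).symm ⟨T s (Λ A k η), h⟩)
    have h3 : V ⟨A, l⟩ ((Λ A l).symm ⟨T s (Λ A k η), h⟩) = T s (Λ A k η) := by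
      change (Λ A l ((Λ A l).symm ⟨T s (Λ A k η), h⟩) : H) = _
      rw [LinearIsometryEquiv.apply_symm_apply]
    rw [hardySumMonomial_apply] at h1 h2
    rw [← h1, ← h2, h3]
    change W (T s (W.symm (W (V ⟨A, k⟩ η)))) = _
    rw [LinearIsometryEquiv.symm_apply_apply]
    rfl
  refine ⟨Λ, hΛ, hshift, hdiag, fun A s => diagonalBlock (X s) A, fun A k i η => ?_,
    fun A k s hs η => ?_, W, fun s y => ?_⟩
  · rw [diagonalBlock_apply, hX _ _ _ _ _ (hshift A k i η), PiLp.single_eq_same]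
  · rw [diagonalBlock_apply, hX _ _ _ _ _ (hdiag A k s hs η), PiLp.single_eq_same]
  -- Each monomial stays in its own summand `A`, so `X s` has no off-diagonal blocks; totality of
  -- the monomials gives equality.
  · have hXM : X s = directSumOperator fun A => diagonalBlock (X s) A := by
      refine ContinuousLinearMap.ext_of_total (V := hardySumMonomial)
        (fun _ => eq_zero_of_forall_inner_hardySumMonomial (ι := fun A : Finset (Fin n) => A)
          (D := fun A => wanderingSubspace T A)) ?_
      rintro ⟨A, k⟩ η
      rw [hardySumMonomial_apply, directSumOperator_single, diagonalBlock_apply]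
      by_cases hs : s ∈ A
      · rw [hX _ _ _ _ _ (hshift A k ⟨s, hs⟩ η), PiLp.single_eq_same]
      · rw [hX _ _ _ _ _ (hdiag A k s hs η), PiLp.single_eq_same]
    exact congrArg (fun Y => Y y) hXM
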